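/- Let $d\ge 1$ and $1\le p<\infty$. The class $N^{1,p}$ consists of all $f\in L^p_{\rm loc}(\mathbb R^d)$ for which there is a nonnegative $g\in L^p(\mathbb R^d)$ with $$|f(x)-f(y)|\le |x-y|\left(e^{g(x)+g(y)}-1\right)$$ for all $x,y$ outside a Lebesgue-null set, and $[f]_{N^{1,p}}$ denotes the infimum of $\|g\|_{L^p}$ over all such $g$. A measurable function $f:\mathbb R^d\to\mathbb R$ is called weakly differentiable at $x$ if there is a linear map $L:\mathbb R^d\to\mathbb R$ such that $$\lim_{r\to0^+}\int_{B_R(0)}\min\left\{\left|\frac{f(x+ry)-f(x)-L(ry)}{r|y|}\right|,1\right\}\,dy=0\qquad\text{for every } 0<R<\infty;$$ in that case one writes $L(y)=\nabla f(x)\cdot y$. Proposition. Every $f\in N^{1,p}$ is weakly differentiable at Lebesgue-almost every point of $\mathbb R^d$. Its weak gradient $\nabla f$, which is defined almost everywhere, is Lebesgue measurable, and (i) $\displaystyle\int_{\mathbb R^d}\log\left(1+|\nabla f(x)|\right)^p\,dx\le C\,[f]_{N^{1,p}}^p$, with a constant $C$ that depends only on $p$; (ii) for almost every $x\in\mathbb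 R^d$, $$\lim_{r\to0^+}\frac{1}{|B_r(0)|}\int_{B_r(0)}\log\left(1+\frac{|f(x+y)-f(x)-\nabla f(x)\cdot y|}{|y|}\right)^p\,dy=0.$$ -/

import Mathlib

open MeasureTheory Filter Topology
open scoped ENNReal NNReal

namespace LogSobolev

/-- `f ∈ L^p_loc(ℝ^d)`, for a real exponent `p`. -/
def MemLpLoc {d : ℕ} (p : ℝ) (f : EuclideanSpace ℝ (Fin d) → ℝ) : Prop :=
  ∀ K : Set (EuclideanSpace ℝ (Fin d)), IsCompact K →
    MemLp f (ENNReal.ofReal p) (volume.restrict K)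

/-- `g` is a nonnegative function in `L^p(ℝ^d)` with
`|f(x) - f(y)| ≤ |x - y|^s (exp(g(x) + g(y)) - 1)`. Since `f` and `g` are elements of Lebesgue
spaces, the inequality is required for all `x, y` outside a Lebesgue null set, so that it does not
depend on the representatives of `f` and `g`. -/
structure IsLogHajlaszGradient {d : ℕ} (s p : ℝ) (f g : EuclideanSpace ℝ (Fin d) → ℝ) :
    Prop where
  nonneg : ∀ᵐ x, 0 ≤ g x
  memLp : MemLp g (ENNReal.ofReal p) volume
  bound : ∃ N : Set (EuclideanSpace ℝ (Fin d)), volume N = 0 ∧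
    ∀ x ∉ N, ∀ y ∉ N, |f x - f y| ≤ ‖x - y‖ ^ s * (Real.exp (g x + g y) - 1)

/-- The class `N^{s,p}`. -/
def MemN {d : ℕ} (s p : ℝ) (f : EuclideanSpace ℝ (Fin d) → ℝ) : Prop :=
  MemLpLoc p f ∧ ∃ g, IsLogHajlaszGradient s p f g

/-- `[f]_{N^{s,p}}`, the infimum of `‖g‖_{L^p}` over all admissible `g`
(`∞` if there is none). -/
noncomputable def seminormN {d : ℕ} (s p : ℝ) (f : EuclideanSpace ℝ (Fin d) → ℝ) : ℝ≥0∞ :=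
  ⨅ (g : EuclideanSpace ℝ (Fin d) → ℝ) (_ : IsLogHajlaszGradient s p f g),
    eLpNorm g (ENNReal.ofReal p) volume

/-- The linear map `L` is a weak differential of `f` at `x`: the quotients
`y ↦ (f(x + r y) - f(x) - L(r y)) / (r |y|)` tend to `0` locally in measure as `r → 0⁺`. -/
def HasWeakDifferentialAt {d : ℕ} (f : EuclideanSpace ℝ (Fin d) → ℝ)
    (L : EuclideanSpace ℝ (Fin d) →ₗ[ℝ] ℝ) (x : EuclideanSpace ℝ (Fin d)) : Prop :=
  ∀ R : ℝ, 0 < R →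
    Tendsto (fun r : ℝ => ∫⁻ y in Metric.ball (0 : EuclideanSpace ℝ (Fin d)) R,
        ENNReal.ofReal (min |(f (x + r • y) - f x - L (r • y)) / (r * ‖y‖)| 1))
      (𝓝[>] 0) (𝓝 0)

/-- `f` is weakly differentiable at `x`. -/
def WeaklyDifferentiableAt {d : ℕ} (f : EuclideanSpace ℝ (Fin d) → ℝ)
    (x : EuclideanSpace ℝ (Fin d)) : Prop :=
  ∃ L : EuclideanSpace ℝ (Fin d) →ₗ[ℝ] ℝ, HasWeakDifferentialAt f L x

/-- The vector `v` is a weak gradient of `f` at `x`: `y ↦ v · y` is a weak differential. -/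
def HasWeakGradientAt {d : ℕ} (f : EuclideanSpace ℝ (Fin d) → ℝ)
    (v x : EuclideanSpace ℝ (Fin d)) : Prop :=
  HasWeakDifferentialAt f (innerₛₗ ℝ v) x

end LogSobolev

/-!
# Weak differentiability of functions with a logarithmic Hajłasz gradient

Let `g` be an admissible gradient of `f`, and let `E` be the set of points, off a null set, where
`g ≤ q`. On `E` the function `f` is Lipschitz with constant `exp (2 q) - 1`, so it extends to a
Lipschitz function on the whole space, which is differentiable almost everywhere by Rademacher's
theorem (`IsBorelGradient.exists_measurable_gradient`). Thus at almost every point of `E` the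
function `f` has a gradient within `E`, and at density points of `E` this is a weak gradient
(`hasWeakGradientAt_of_hasGradientWithinAt`). Countably many sets `E` cover almost everything, and
weak gradients are unique (`HasWeakGradientAt.unique`), so the weak gradient exists almost everywhere
and coincides on each `E` with a Borel function. Taking rational `q` close to `g x` gives
`|∇f x| ≤ exp (2 g x) - 1`, that is, `log (1 + |∇f|) ≤ 2 g`, which is (i) with `C = 2 ^ p`.

For (ii), fix a good point `x` of `E`. Increments that stay in `E` have small difference quotients by
differentiability within `E`. If `z = x + y` is outside `E`, then `g x ≤ q < g z`, and the pointwise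
inequality and the bound on the gradient give `log (1 + |f z - f x - ∇f x · y| / |y|) ≤ 4 g z`. The
function equal to `g ^ p` off `E` and to zero on `E` is integrable, so by Lebesgue's differentiation theorem
its averages over small balls around almost every `x ∈ E` tend to zero
(`IsBorelGradient.tendsto_laverage_log`). By Chebyshev's inequality such an `x` is moreover a density
point of `E`, so no separate density theorem is needed.
-/

namespace LogSobolev

open InnerProductSpace

variable {d : ℕ} {p q : ℝ} {f g G : EuclideanSpace ℝ (Fin d) → ℝ}
  {T E : Set (EuclideanSpace ℝ (Fin d))} {v w x : EuclideanSpace ℝ (Fin d)}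

/-! ### Density points and weak gradients -/

/-- Lebesgue's differentiation theorem along open balls. -/
theorem ae_tendsto_lintegral_ball_div {h : EuclideanSpace ℝ (Fin d) → ℝ≥0∞}
    (hh : AEMeasurable h) (hfin : ∫⁻ z, h z ≠ ∞) :
    ∀ᵐ x, Tendsto (fun r : ℝ => (∫⁻ z in Metric.ball x r, h z) / volume (Metric.ball x r))
      (𝓝[>] 0) (𝓝 (h x)) := by
  filter_upwards [(Besicovitch.vitaliFamily volume).ae_tendsto_lintegral_div hh hfin] with x hx
  refine (hx.comp (Besicovitch.tendsto_filterAt volume x)).congr' ?_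
  filter_upwards [self_mem_nhdsWithin] with r hr
  have hr0 : r ≠ 0 := ne_of_gt hr
  have hae : Metric.closedBall x r =ᵐ[volume] Metric.ball x r := by
    refine (ae_eq_of_subset_of_measure_ge Metric.ball_subset_closedBall ?_
      measurableSet_ball.nullMeasurableSet ?_).symm
    · rw [← Metric.ball_union_sphere]
      refine (measure_union_le _ _).trans ?_
      rw [Measure.addHaar_sphere_of_ne_zero volume x hr0, add_zero]
    · exact measure_closedBall_lt_top.ne
  simp only [Function.comp_apply]
  rw [Measure.restrict_congr_set hae, measure_congr hae]

theorem volume_setOf_add_smul_mem {r : ℝ} (hr : r ≠ 0) (x : EuclideanSpace ℝ (Fin d))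
    (A : Set (EuclideanSpace ℝ (Fin d))) :
    volume {y | x + r • y ∈ A} = ENNReal.ofReal |(r ^ d)⁻¹| * volume A := by
  have h := Measure.addHaar_preimage_smul (volume : Measure (EuclideanSpace ℝ (Fin d))) hr
    ((x + ·) ⁻¹' A)
  rw [measure_preimage_add, finrank_euclideanSpace_fin] at h
  exact h

/-- Rescaling turns the fraction of `B(x, rR)` outside `E` into the volume of the part of `B(0, R)`
seen outside `E` at scale `r`. -/
theorem tendsto_volume_blowup
    (hE : Tendsto (fun r : ℝ => volume (Metric.ball x r ∩ Eᶜ) / volume (Metric.ball x r))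
      (𝓝[>] 0) (𝓝 0)) {R : ℝ} (hR : 0 < R) :
    Tendsto (fun r : ℝ => volume (Metric.ball 0 R ∩ {y | x + r • y ∈ Eᶜ})) (𝓝[>] 0) (𝓝 0) := by
  have hscale : Tendsto (fun r : ℝ => r * R) (𝓝[>] 0) (𝓝[>] 0) := by
    refine tendsto_nhdsWithin_iff.2 ⟨?_, ?_⟩
    · have : Tendsto (fun r : ℝ => r * R) (𝓝 0) (𝓝 (0 * R)) :=
        (continuous_id.mul continuous_const).tendsto 0
      rw [zero_mul] at this
      exact this.mono_left nhdsWithin_le_nhds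
    · filter_upwards [self_mem_nhdsWithin] with r hr
      exact mul_pos hr hR
  have h1 := ENNReal.Tendsto.mul_const (hE.comp hscale)
    (Or.inr (measure_ball_lt_top (μ := volume) (x := (0 : EuclideanSpace ℝ (Fin d))) (r := R)).ne)
  rw [zero_mul] at h1
  refine h1.congr' ?_
  filter_upwards [self_mem_nhdsWithin] with r hr
  have hr : 0 < r := hr
  have hball : (Metric.ball 0 R : Set (EuclideanSpace ℝ (Fin d)))
      = {y | x + r • y ∈ Metric.ball x (r * R)} := by
    ext y
    simp [norm_smul, abs_of_pos hr, hr]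
  have hinter : Metric.ball 0 R ∩ {y | x + r • y ∈ Eᶜ}
      = {y | x + r • y ∈ Metric.ball x (r * R) ∩ Eᶜ} := by
    rw [hball]; rfl
  rw [hinter, volume_setOf_add_smul_mem hr.ne', hball, volume_setOf_add_smul_mem hr.ne',
    mul_left_comm, Function.comp_apply, ENNReal.div_mul_cancel
      (Metric.measure_ball_pos volume x (mul_pos hr hR)).ne' measure_ball_lt_top.ne]

/-- The defining estimate of the gradient within `E`, in terms of increments. -/
theorem eventually_abs_sub_inner_le (hf : HasGradientWithinAt f w E x) {ε : ℝ} (hε : 0 < ε) :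
    ∀ᶠ r : ℝ in 𝓝[>] 0, ∀ y : EuclideanSpace ℝ (Fin d), ‖y‖ < r → x + y ∈ E →
      |f (x + y) - f x - inner ℝ w y| ≤ ε * ‖y‖ := by
  have h := hf.hasFDerivWithinAt.isLittleO.def hε
  rw [eventually_nhdsWithin_iff, Metric.eventually_nhds_iff] at h
  obtain ⟨δ, hδ, h⟩ := h
  filter_upwards [Ioo_mem_nhdsGT hδ] with r hr y hy hyE
  have := h (y := x + y) (by simpa using hy.trans hr.2) hyE
  simpa using this

/-- A gradient within a set of which `x` is a density point is a weak gradient at `x`. -/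
theorem hasWeakGradientAt_of_hasGradientWithinAt (hEm : MeasurableSet E)
    (hf : HasGradientWithinAt f w E x)
    (hE : Tendsto (fun r : ℝ => volume (Metric.ball x r ∩ Eᶜ) / volume (Metric.ball x r))
      (𝓝[>] 0) (𝓝 0)) :
    HasWeakGradientAt f w x := by
  intro R hR
  rw [ENNReal.tendsto_nhds_zero]
  intro ε hε
  have hhalf : 0 < ε / 2 := ENNReal.half_pos hε.ne'
  obtain ⟨η, hη0, hη⟩ : ∃ η : ℝ, 0 < η ∧
      ENNReal.ofReal η * volume (Metric.ball (0 : EuclideanSpace ℝ (Fin d)) R) ≤ ε / 2 := by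
    have h1 : Tendsto (fun η : ℝ => ENNReal.ofReal η *
        volume (Metric.ball (0 : EuclideanSpace ℝ (Fin d)) R)) (𝓝[>] 0) (𝓝 0) := by
      have h2 : Tendsto (fun η : ℝ => ENNReal.ofReal η) (𝓝[>] 0) (𝓝 0) := by
        simpa using (ENNReal.continuous_ofReal.tendsto 0).mono_left nhdsWithin_le_nhds
      simpa using ENNReal.Tendsto.mul_const h2 (Or.inr measure_ball_lt_top.ne)
    obtain ⟨η, h3, h4⟩ := ((ENNReal.tendsto_nhds_zero.1 h1 _ hhalf).and self_mem_nhdsWithin).exists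
    exact ⟨η, h4, h3⟩
  obtain ⟨δ, hδ, hδ0⟩ := ((eventually_abs_sub_inner_le hf hη0).and self_mem_nhdsWithin).exists
  have hδ0 : 0 < δ := hδ0
  filter_upwards [Ioo_mem_nhdsGT (div_pos hδ0 hR),
    ENNReal.tendsto_nhds_zero.1 (tendsto_volume_blowup hE hR) _ hhalf] with r hr hvol
  have hr0 : 0 < r := hr.1
  have hpt : ∀ y ∈ Metric.ball (0 : EuclideanSpace ℝ (Fin d)) R,
      ENNReal.ofReal (min |(f (x + r • y) - f x - (innerₛₗ ℝ w) (r • y)) / (r * ‖y‖)| 1)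
        ≤ ENNReal.ofReal η + Set.indicator {y | x + r • y ∈ Eᶜ} 1 y := by
    intro y hy
    rw [mem_ball_zero_iff] at hy
    by_cases hyE : x + r • y ∈ E
    · refine le_add_right (ENNReal.ofReal_le_ofReal ((min_le_left _ _).trans ?_))
      have hry : ‖r • y‖ = r * ‖y‖ := by rw [norm_smul, Real.norm_of_nonneg hr0.le]
      have hlt : ‖r • y‖ < δ := by
        rw [hry]
        calc r * ‖y‖ < δ / R * R := mul_lt_mul'' hr.2 hy hr0.le (norm_nonneg _)
          _ = δ := div_mul_cancel₀ _ hR.ne'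
      have h1 := hδ _ hlt hyE
      rw [abs_div, ← hry, abs_norm]
      exact div_le_of_le_mul₀ (norm_nonneg _) hη0.le h1
    · refine le_add_left ?_
      rw [Set.indicator_of_mem (by exact hyE), Pi.one_apply, ENNReal.ofReal_le_one]
      exact min_le_right _ _
  have hmeas : MeasurableSet {y | x + r • y ∈ Eᶜ} :=
    hEm.compl.preimage (by fun_prop : Measurable fun y : EuclideanSpace ℝ (Fin d) => x + r • y)
  calc _ ≤ ∫⁻ y in Metric.ball (0 : EuclideanSpace ℝ (Fin d)) R,
        (ENNReal.ofReal η + Set.indicator {y | x + r • y ∈ Eᶜ} 1 y) :=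
        setLIntegral_mono' measurableSet_ball hpt
    _ ≤ ε / 2 + ε / 2 := by
        rw [lintegral_add_left measurable_const, lintegral_indicator_one hmeas,
          Measure.restrict_apply hmeas, setLIntegral_const, Set.inter_comm]
        exact add_le_add hη hvol
    _ = ε := ENNReal.add_halves ε

/-- Weak gradients of a measurable function are unique: the truncated quotient
`min (|⟪v - w, y⟫| / ‖y‖) 1` does not depend on the scale, so its integral over the unit ball
vanishes, and a proper subspace cannot contain almost all of the ball. -/
theorem HasWeakGradientAt.unique (hf : AEMeasurable f) (hv : HasWeakGradientAt f v x)
    (hw : HasWeakGradientAt f w x) : v = w := by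
  set B := Metric.ball (0 : EuclideanSpace ℝ (Fin d)) 1
  let u : EuclideanSpace ℝ (Fin d) → ℝ≥0∞ := fun y =>
    ENNReal.ofReal (min |(inner ℝ (v - w) y) / ‖y‖| 1)
  have hint : ∫⁻ y in B, u y ≤ 0 := by
    have hsum := (hw 1 one_pos).add (hv 1 one_pos)
    rw [add_zero] at hsum
    refine ge_of_tendsto hsum ?_
    filter_upwards [self_mem_nhdsWithin] with r hr
    have hr : 0 < r := hr
    have hqmp : Measure.QuasiMeasurePreserving
        (fun y : EuclideanSpace ℝ (Fin d) => x + r • y) volume volume :=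
      (measurePreserving_add_left volume x).quasiMeasurePreserving.comp
        (Measure.quasiMeasurePreserving_smul volume hr.ne')
    have hfr : AEMeasurable (fun y => f (x + r • y)) := hf.comp_quasiMeasurePreserving hqmp
    rw [← lintegral_add_left']
    · refine lintegral_mono fun y => ?_
      rw [← ENNReal.ofReal_add (by positivity) (by positivity)]
      refine ENNReal.ofReal_le_ofReal ?_
      have hid : inner ℝ (v - w) y / ‖y‖
          = (f (x + r • y) - f x - (innerₛₗ ℝ w) (r • y)) / (r * ‖y‖)
            - (f (x + r • y) - f x - (innerₛₗ ℝ v) (r • y)) / (r * ‖y‖) := by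
        rw [← sub_div, ← mul_div_mul_left _ _ hr.ne']
        congr 1
        simp only [innerₛₗ_apply_apply, inner_smul_right, inner_sub_left]
        ring
      rw [hid]
      generalize (f (x + r • y) - f x - (innerₛₗ ℝ w) (r • y)) / (r * ‖y‖) = a
      generalize (f (x + r • y) - f x - (innerₛₗ ℝ v) (r • y)) / (r * ‖y‖) = b
      have := abs_sub a b
      have := abs_nonneg a
      have := abs_nonneg b
      rcases le_total |a| 1 with ha | ha <;> rcases le_total |b| 1 with hb | hb <;>
        simp only [ha, hb, min_eq_left, min_eq_right] <;>
        first
          | exact (min_le_left _ _).trans this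
          | exact (min_le_left _ _).trans (by assumption)
          | exact (min_le_right _ _).trans (by linarith)
    · have hinner : Measurable fun y => (innerₛₗ ℝ w) (r • y) := by
        simp only [innerₛₗ_apply_apply]
        fun_prop
      refine AEMeasurable.restrict ?_
      have hq := ((hfr.sub_const (f x)).sub hinner.aemeasurable).div
        (by fun_prop : AEMeasurable fun y : EuclideanSpace ℝ (Fin d) => r * ‖y‖)
      exact ((measurable_norm.comp_aemeasurable hq).min aemeasurable_const).ennreal_ofReal
  have hu : Measurable u := by fun_prop
  have hae := (setLIntegral_eq_zero_iff measurableSet_ball hu).1 (le_antisymm hint bot_le)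
  have hvanish : ∀ᵐ y, y ∈ B → y ∈ (innerₛₗ ℝ (v - w)).ker := by
    filter_upwards [hae] with y hy hyB
    have h1 := hy hyB
    rcases eq_or_ne y 0 with rfl | hy0
    · exact Submodule.zero_mem _
    have hmin : min |inner ℝ (v - w) y / ‖y‖| 1 ≤ 0 := ENNReal.ofReal_eq_zero.1 h1
    have h2 : |inner ℝ (v - w) y / ‖y‖| ≤ 0 := by
      rcases min_le_iff.1 hmin with h | h
      · exact h
      · norm_num at h
    have h3 := abs_nonpos_iff.1 h2
    rw [div_eq_zero_iff, or_iff_left (norm_ne_zero_iff.2 hy0)] at h3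
    exact h3
  by_contra hne
  have hker : (innerₛₗ ℝ (v - w)).ker ≠ ⊤ := by
    intro htop
    have hmem : v - w ∈ (innerₛₗ ℝ (v - w)).ker := htop ▸ Submodule.mem_top
    rw [LinearMap.mem_ker, innerₛₗ_apply_apply, inner_self_eq_zero] at hmem
    exact hne (sub_eq_zero.1 hmem)
  have hB : volume B = 0 := measure_mono_null_ae hvanish
    (Measure.addHaar_submodule volume _ hker)
  exact (Metric.measure_ball_pos volume _ one_pos).ne' hB

theorem MemLpLoc.aemeasurable (hf : MemLpLoc p f) : AEMeasurable f := by
  have h : AEMeasurable f (volume.restrict (⋃ n : ℕ, Metric.closedBall 0 (n : ℝ))) :=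
    aemeasurable_iUnion_iff.2 fun n => (hf _ (isCompact_closedBall 0 n)).1.aemeasurable
  rwa [Metric.iUnion_closedBall_nat, Measure.restrict_univ] at h

/-! ### Sublevel sets of a gradient -/

/-- A gradient in the sense of `IsLogHajlaszGradient` for exponent `s = 1`, with a regular choice of
representative: `G` is Borel, and outside the Borel null set `T` it is nonnegative and the pointwise
inequality holds. -/
structure IsBorelGradient (f G : EuclideanSpace ℝ (Fin d) → ℝ)
    (T : Set (EuclideanSpace ℝ (Fin d))) : Prop where
  measurable : Measurable G
  measurableSet : MeasurableSet T
  null : volume T = 0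
  nonneg : ∀ x ∉ T, 0 ≤ G x
  bound : ∀ x ∉ T, ∀ y ∉ T, |f x - f y| ≤ ‖x - y‖ * (Real.exp (G x + G y) - 1)

theorem IsLogHajlaszGradient.exists_isBorelGradient (hg : IsLogHajlaszGradient 1 p f g) :
    ∃ G T, IsBorelGradient f G T ∧ g =ᵐ[volume] G := by
  obtain ⟨N, hN, hb⟩ := hg.bound
  have hgm := hg.memLp.1.aemeasurable
  set M := N ∪ ({x | ¬ 0 ≤ g x} ∪ {x | ¬ g x = hgm.mk g x})
  have hM : volume M = 0 :=
    measure_union_null hN (measure_union_null (ae_iff.1 hg.nonneg) (ae_iff.1 hgm.ae_eq_mk))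
  have hT : ∀ x ∉ toMeasurable volume M, x ∉ N ∧ 0 ≤ g x ∧ g x = hgm.mk g x := by
    intro x hx
    have : x ∉ M := fun h => hx (subset_toMeasurable _ _ h)
    simpa [M] using this
  refine ⟨hgm.mk g, toMeasurable volume M, ⟨hgm.measurable_mk, measurableSet_toMeasurable _ _,
    by rw [measure_toMeasurable, hM], fun x hx => ?_, fun x hx y hy => ?_⟩, hgm.ae_eq_mk⟩
  · rw [← (hT x hx).2.2]
    exact (hT x hx).2.1
  · rw [← (hT x hx).2.2, ← (hT y hy).2.2, ← Real.rpow_one ‖x - y‖]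
    exact hb x (hT x hx).1 y (hT y hy).1

/-- The set of points outside `T` at which `G ≤ q`. -/
def sublevel (G : EuclideanSpace ℝ (Fin d) → ℝ) (T : Set (EuclideanSpace ℝ (Fin d))) (q : ℝ) :
    Set (EuclideanSpace ℝ (Fin d)) :=
  {x | x ∉ T ∧ G x ≤ q}

/-- The `p`-th power of `G`, cut off to the complement of the sublevel set. -/
noncomputable def tailPow (p : ℝ) (G : EuclideanSpace ℝ (Fin d) → ℝ)
    (T : Set (EuclideanSpace ℝ (Fin d))) (q : ℝ) : EuclideanSpace ℝ (Fin d) → ℝ≥0∞ :=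
  (sublevel G T q)ᶜ.indicator fun z => ENNReal.ofReal (G z ^ p)

namespace IsBorelGradient

theorem measurableSet_sublevel (hG : IsBorelGradient f G T) (q : ℝ) :
    MeasurableSet (sublevel G T q) :=
  hG.measurableSet.compl.inter (measurableSet_le hG.measurable measurable_const)

theorem measurable_tailPow (hG : IsBorelGradient f G T) (q : ℝ) :
    Measurable (tailPow p G T q) :=
  (hG.measurable.pow_const p).ennreal_ofReal.indicator (hG.measurableSet_sublevel q).compl

theorem ae_notMem (hG : IsBorelGradient f G T) : ∀ᵐ x, x ∉ T :=
  measure_eq_zero_iff_ae_notMem.1 hG.null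

/-- On the sublevel set `{G ≤ q}` the function `f` is Lipschitz with constant `exp (2 q) - 1`, so it
agrees there with a Lipschitz function, to which Rademacher's theorem applies. -/
theorem exists_measurable_gradient (hG : IsBorelGradient f G T) (hq : 0 < q) :
    ∃ u : EuclideanSpace ℝ (Fin d) → EuclideanSpace ℝ (Fin d), Measurable u ∧
      (∀ x, ‖u x‖ ≤ Real.exp (2 * q) - 1) ∧
      ∀ᵐ x, x ∈ sublevel G T q → HasGradientWithinAt f (u x) (sublevel G T q) x := by
  have hC : 0 ≤ Real.exp (2 * q) - 1 := by
    have := Real.one_le_exp (by positivity : 0 ≤ 2 * q)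
    linarith
  have hlip : LipschitzOnWith (Real.toNNReal (Real.exp (2 * q) - 1)) f (sublevel G T q) := by
    refine LipschitzOnWith.of_dist_le_mul fun x hx y hy => ?_
    rw [Real.coe_toNNReal _ hC, Real.dist_eq, dist_eq_norm, mul_comm]
    refine (hG.bound x hx.1 y hy.1).trans (mul_le_mul_of_nonneg_left ?_ (norm_nonneg _))
    have := Real.exp_le_exp.2 (by linarith [hx.2, hy.2] : G x + G y ≤ 2 * q)
    linarith
  obtain ⟨F, hF, hFf⟩ := hlip.extend_real
  refine ⟨fun x => (toDual ℝ _).symm (fderiv ℝ F x), ?_, fun x => ?_, ?_⟩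
  · exact (toDual ℝ (EuclideanSpace ℝ (Fin d))).symm.continuous.measurable.comp
      (measurable_fderiv ℝ F)
  · rw [LinearIsometryEquiv.norm_map]
    simpa [hC] using norm_fderiv_le_of_lipschitz ℝ (x₀ := x) hF
  · filter_upwards [hF.ae_differentiableAt (μ := volume)] with x hx hxE
    have hgrad : HasGradientAt F ((toDual ℝ _).symm (fderiv ℝ F x)) x := hx.hasGradientAt
    rw [hasGradientWithinAt_iff_hasFDerivWithinAt]
    exact hgrad.hasFDerivAt.hasFDerivWithinAt.congr hFf (hFf hxE)

theorem ae_tendsto_tailPow (hG : IsBorelGradient f G T) (q : ℝ)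
    (hfin : ∫⁻ z, ENNReal.ofReal (G z ^ p) ≠ ∞) :
    ∀ᵐ x, x ∈ sublevel G T q → Tendsto (fun r : ℝ =>
      (∫⁻ z in Metric.ball x r, tailPow p G T q z) / volume (Metric.ball x r)) (𝓝[>] 0) (𝓝 0) := by
  have hle : ∫⁻ z, tailPow p G T q z ≤ ∫⁻ z, ENNReal.ofReal (G z ^ p) :=
    lintegral_mono fun z => Set.indicator_le_self _ _ z
  filter_upwards [ae_tendsto_lintegral_ball_div (hG.measurable_tailPow q).aemeasurable
    (hle.trans_lt hfin.lt_top).ne] with x hx hxE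
  rwa [tailPow, Set.indicator_of_notMem (by simpa using hxE)] at hx

theorem lt_of_notMem_sublevel {z : EuclideanSpace ℝ (Fin d)} (hz : z ∉ T)
    (hzE : z ∉ sublevel G T q) : q < G z := by
  by_contra h
  exact hzE ⟨hz, not_lt.1 h⟩

/-- By Chebyshev's inequality, a point at which the averages of the tail vanish is a density point
of the sublevel set. -/
theorem tendsto_density (hG : IsBorelGradient f G T) (hp : 0 ≤ p) (hq : 0 < q)
    (hx : Tendsto (fun r : ℝ =>
      (∫⁻ z in Metric.ball x r, tailPow p G T q z) / volume (Metric.ball x r)) (𝓝[>] 0) (𝓝 0)) :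
    Tendsto (fun r : ℝ => volume (Metric.ball x r ∩ (sublevel G T q)ᶜ) / volume (Metric.ball x r))
      (𝓝[>] 0) (𝓝 0) := by
  have hqp : 0 < ENNReal.ofReal (q ^ p) := ENNReal.ofReal_pos.2 (Real.rpow_pos_of_pos hq p)
  have h := ENNReal.Tendsto.const_mul (a := (ENNReal.ofReal (q ^ p))⁻¹) hx
    (Or.inr (ENNReal.inv_ne_top.2 hqp.ne'))
  rw [mul_zero] at h
  refine tendsto_of_tendsto_of_tendsto_of_le_of_le tendsto_const_nhds h (fun _ => bot_le) fun r => ?_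
  simp only
  rw [← mul_div_assoc]
  refine ENNReal.div_le_div_right ?_ _
  have hE := (hG.measurableSet_sublevel q).compl
  rw [← ENNReal.mul_le_iff_le_inv hqp.ne' ENNReal.ofReal_ne_top, Set.inter_comm,
    ← Measure.restrict_apply hE, ← lintegral_indicator_const hE]
  refine lintegral_mono_ae (ae_restrict_of_ae ?_)
  filter_upwards [hG.ae_notMem] with z hz
  refine Set.indicator_le_indicator' fun hzE => ENNReal.ofReal_le_ofReal ?_
  exact Real.rpow_le_rpow hq.le (lt_of_notMem_sublevel hz hzE).le hp

/-- At a good point of the sublevel set the logarithmic difference quotient is uniformly small on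
increments that stay in the sublevel set, and elsewhere it is at most `4 G`; the averages
of `G ^ p` over the latter region vanish in the limit. -/
theorem tendsto_laverage_log (hG : IsBorelGradient f G T) (hp : 0 < p) (hq : 0 < q)
    (hxE : x ∈ sublevel G T q) (hw : ‖w‖ ≤ Real.exp (2 * q) - 1)
    (hf : HasGradientWithinAt f w (sublevel G T q) x)
    (hx : Tendsto (fun r : ℝ =>
      (∫⁻ z in Metric.ball x r, tailPow p G T q z) / volume (Metric.ball x r)) (𝓝[>] 0) (𝓝 0)) :
    Tendsto (fun r : ℝ => ⨍⁻ y in Metric.ball (0 : EuclideanSpace ℝ (Fin d)) r,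
      ENNReal.ofReal (Real.log (1 + |f (x + y) - f x - inner ℝ w y| / ‖y‖) ^ p) ∂volume)
      (𝓝[>] 0) (𝓝 0) := by
  rw [ENNReal.tendsto_nhds_zero]
  intro ε hε
  have hhalf : 0 < ε / 2 := ENNReal.half_pos hε.ne'
  obtain ⟨η, hη0, hη⟩ : ∃ η : ℝ, 0 < η ∧ ENNReal.ofReal (η ^ p) ≤ ε / 2 := by
    have h1 : Tendsto (fun η : ℝ => ENNReal.ofReal (η ^ p)) (𝓝[>] 0) (𝓝 0) := by
      have h2 := (Real.continuousAt_rpow_const 0 p (Or.inr hp.le)).tendsto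
      rw [Real.zero_rpow hp.ne'] at h2
      simpa [Function.comp_def] using
        (ENNReal.continuous_ofReal.tendsto 0).comp (h2.mono_left nhdsWithin_le_nhds)
    obtain ⟨η, h3, h4⟩ := ((ENNReal.tendsto_nhds_zero.1 h1 _ hhalf).and self_mem_nhdsWithin).exists
    exact ⟨η, h4, h3⟩
  have htail := ENNReal.Tendsto.const_mul (a := ENNReal.ofReal (4 ^ p)) hx
    (Or.inr ENNReal.ofReal_ne_top)
  rw [mul_zero] at htail
  filter_upwards [eventually_abs_sub_inner_le hf hη0,
    ENNReal.tendsto_nhds_zero.1 htail _ hhalf, self_mem_nhdsWithin] with r hr hrtail hr0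
  have hr0 : 0 < r := hr0
  have hT : ∀ᵐ y, x + y ∉ T :=
    (measurePreserving_add_left volume x).quasiMeasurePreserving.ae hG.ae_notMem
  have hlog : ∀ a : ℝ, 0 ≤ a → 0 ≤ Real.log (1 + a) := fun a ha => Real.log_nonneg (by linarith)
  have hpt : ∀ᵐ y, y ∈ Metric.ball (0 : EuclideanSpace ℝ (Fin d)) r →
      ENNReal.ofReal (Real.log (1 + |f (x + y) - f x - inner ℝ w y| / ‖y‖) ^ p)
        ≤ ENNReal.ofReal (η ^ p) + ENNReal.ofReal (4 ^ p) * tailPow p G T q (x + y) := by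
    filter_upwards [hT] with y hyT hy
    rw [mem_ball_zero_iff] at hy
    have hquot : 0 ≤ |f (x + y) - f x - inner ℝ w y| / ‖y‖ := by positivity
    by_cases hyE : x + y ∈ sublevel G T q
    · refine le_add_right (ENNReal.ofReal_le_ofReal (Real.rpow_le_rpow (hlog _ hquot) ?_ hp.le))
      have h1 : |f (x + y) - f x - inner ℝ w y| / ‖y‖ ≤ η :=
        div_le_of_le_mul₀ (norm_nonneg _) hη0.le (hr y hy hyE)
      have h2 := Real.log_le_sub_one_of_pos
        (by linarith : 0 < 1 + |f (x + y) - f x - inner ℝ w y| / ‖y‖)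
      linarith
    · refine le_add_left ?_
      have hqG := lt_of_notMem_sublevel hyT hyE
      have hG0 : 0 ≤ G (x + y) := hG.nonneg _ hyT
      rw [tailPow, Set.indicator_of_mem (by exact hyE), ← ENNReal.ofReal_mul (by positivity),
        ← Real.mul_rpow (by norm_num) hG0]
      refine ENNReal.ofReal_le_ofReal (Real.rpow_le_rpow (hlog _ hquot) ?_ hp.le)
      rw [Real.log_le_iff_le_exp (by linarith)]
      have hb := hG.bound (x + y) hyT x hxE.1
      rw [add_sub_cancel_left] at hb
      have hin : |inner ℝ w y| ≤ ‖y‖ * (Real.exp (2 * q) - 1) := by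
        rw [mul_comm]
        exact (abs_real_inner_le_norm w y).trans (by gcongr)
      have hle : |f (x + y) - f x - inner ℝ w y| / ‖y‖
          ≤ (Real.exp (G (x + y) + G x) - 1) + (Real.exp (2 * q) - 1) := by
        have h1 := Real.one_le_exp (add_nonneg hG0 (hG.nonneg x hxE.1))
        have h2 := Real.one_le_exp (by positivity : 0 ≤ 2 * q)
        refine div_le_of_le_mul₀ (norm_nonneg _) (by linarith) ?_
        have := abs_sub (f (x + y) - f x) (inner ℝ w y)
        linarith
      have h1 : Real.exp (G (x + y) + G x) ≤ Real.exp (2 * G (x + y)) :=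
        Real.exp_le_exp.2 (by linarith [hxE.2])
      have h2 : Real.exp (2 * q) ≤ Real.exp (2 * G (x + y)) := Real.exp_le_exp.2 (by linarith)
      have h3 : Real.exp (4 * G (x + y))
          = Real.exp (2 * G (x + y)) * Real.exp (2 * G (x + y)) := by
        rw [← Real.exp_add]; ring_nf
      rw [h3]
      -- `2 E - 1 ≤ E ^ 2` for `E = exp (2 G)`
      nlinarith [sq_nonneg (Real.exp (2 * G (x + y)) - 1)]
  have hshift : ∫⁻ y in Metric.ball (0 : EuclideanSpace ℝ (Fin d)) r, tailPow p G T q (x + y)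
      = ∫⁻ z in Metric.ball x r, tailPow p G T q z := by
    have h := (measurePreserving_add_left volume x).setLIntegral_comp_preimage
      (measurableSet_ball (x := x) (ε := r)) (hG.measurable_tailPow (p := p) q)
    rwa [preimage_add_ball, sub_self] at h
  have hvol : volume (Metric.ball (0 : EuclideanSpace ℝ (Fin d)) r) = volume (Metric.ball x r) :=
    (Measure.addHaar_ball_center volume x r).symm
  have hm : Measurable fun y => tailPow p G T q (x + y) :=
    (hG.measurable_tailPow q).comp (measurable_const_add x)
  rw [setLAverage_eq]
  calc _ ≤ (∫⁻ y in Metric.ball (0 : EuclideanSpace ℝ (Fin d)) r,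
        (ENNReal.ofReal (η ^ p) + ENNReal.ofReal (4 ^ p) * tailPow p G T q (x + y)))
          / volume (Metric.ball (0 : EuclideanSpace ℝ (Fin d)) r) :=
        ENNReal.div_le_div_right
          (lintegral_mono_ae ((ae_restrict_iff' measurableSet_ball).2 hpt)) _
    _ = ENNReal.ofReal (η ^ p) + ENNReal.ofReal (4 ^ p) *
          ((∫⁻ z in Metric.ball x r, tailPow p G T q z) / volume (Metric.ball x r)) := by
        rw [lintegral_add_left measurable_const, setLIntegral_const, lintegral_const_mul _ hm,
          hshift, hvol, ENNReal.add_div, mul_div_assoc, mul_div_assoc,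
          ENNReal.div_self (Metric.measure_ball_pos volume x hr0).ne' measure_ball_lt_top.ne,
          mul_one]
    _ ≤ ε / 2 + ε / 2 := add_le_add hη hrtail
    _ = ε := ENNReal.add_halves ε

/-- Almost every point of a sublevel set is good: there `f` has a weak gradient, bounded by
`exp (2 q) - 1`, which is a Borel function of the point, and the logarithmic averages vanish. -/
theorem exists_weakGradient_on_sublevel (hG : IsBorelGradient f G T) (hp : 0 < p) (hq : 0 < q)
    (hfin : ∫⁻ z, ENNReal.ofReal (G z ^ p) ≠ ∞) :
    ∃ u : EuclideanSpace ℝ (Fin d) → EuclideanSpace ℝ (Fin d), Measurable u ∧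
      (∀ x, ‖u x‖ ≤ Real.exp (2 * q) - 1) ∧
      ∀ᵐ x, x ∈ sublevel G T q → HasWeakGradientAt f (u x) x ∧
        Tendsto (fun r : ℝ => ⨍⁻ y in Metric.ball (0 : EuclideanSpace ℝ (Fin d)) r,
          ENNReal.ofReal (Real.log (1 + |f (x + y) - f x - inner ℝ (u x) y| / ‖y‖) ^ p) ∂volume)
          (𝓝[>] 0) (𝓝 0) := by
  obtain ⟨u, hum, hub, hu⟩ := hG.exists_measurable_gradient hq
  refine ⟨u, hum, hub, ?_⟩
  filter_upwards [hu, hG.ae_tendsto_tailPow q hfin] with x hux htail hxE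
  exact ⟨hasWeakGradientAt_of_hasGradientWithinAt (hG.measurableSet_sublevel q) (hux hxE)
    (hG.tendsto_density hp.le hq (htail hxE)),
    hG.tendsto_laverage_log hp hq hxE (hub x) (hux hxE) (htail hxE)⟩

/-- A weak gradient is almost everywhere controlled by `G`: for each rational `q ≥ G x` it is at
most `exp (2 q) - 1`. -/
theorem ae_log_norm_weakGradient_le (hG : IsBorelGradient f G T) (hp : 0 < p)
    (hfin : ∫⁻ z, ENNReal.ofReal (G z ^ p) ≠ ∞) (hf : AEMeasurable f)
    {Df : EuclideanSpace ℝ (Fin d) → EuclideanSpace ℝ (Fin d)}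
    (hDf : ∀ᵐ x, HasWeakGradientAt f (Df x) x) :
    ∀ᵐ x, Real.log (1 + ‖Df x‖) ≤ 2 * G x := by
  have hall : ∀ q : ℚ, ∀ᵐ x, 0 < (q : ℝ) → x ∈ sublevel G T q →
      Real.log (1 + ‖Df x‖) ≤ 2 * q := by
    intro q
    by_cases hq : 0 < (q : ℝ)
    · obtain ⟨u, -, hub, hu⟩ := hG.exists_weakGradient_on_sublevel hp hq hfin
      filter_upwards [hu, hDf] with x hux hDx _ hxE
      rw [hDx.unique hf (hux hxE).1, Real.log_le_iff_le_exp (by positivity)]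
      linarith [hub x]
    · exact Eventually.of_forall fun x h => absurd h hq
  filter_upwards [ae_all_iff.2 hall, hG.ae_notMem] with x hx hxT
  refine le_of_forall_gt_imp_ge_of_dense fun a ha => ?_
  obtain ⟨q, hq1, hq2⟩ := exists_rat_btwn (show G x < a / 2 by linarith)
  have := hx q ((hG.nonneg x hxT).trans_lt hq1) ⟨hxT, hq1.le⟩
  linarith

end IsBorelGradient

theorem IsLogHajlaszGradient.lintegral_rpow_eq (hp : 0 < p) (hg : IsLogHajlaszGradient 1 p f g)
    (hgG : g =ᵐ[volume] G) :
    ∫⁻ z, ENNReal.ofReal (G z ^ p) = eLpNorm g (ENNReal.ofReal p) volume ^ p := by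
  rw [eLpNorm_eq_lintegral_rpow_enorm_toReal (by simpa using hp) ENNReal.ofReal_ne_top,
    ENNReal.toReal_ofReal hp.le, ← ENNReal.rpow_mul, one_div_mul_cancel hp.ne', ENNReal.rpow_one]
  refine lintegral_congr_ae ?_
  filter_upwards [hgG, hg.nonneg] with z hz hz0
  rw [← hz, Real.enorm_eq_ofReal hz0, ENNReal.ofReal_rpow_of_nonneg hz0 hp.le]

theorem IsLogHajlaszGradient.lintegral_log_weakGradient_le (hp : 0 < p)
    (hg : IsLogHajlaszGradient 1 p f g) (hf : AEMeasurable f)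
    {Df : EuclideanSpace ℝ (Fin d) → EuclideanSpace ℝ (Fin d)}
    (hDf : ∀ᵐ x, HasWeakGradientAt f (Df x) x) :
    ∫⁻ x, ENNReal.ofReal (Real.log (1 + ‖Df x‖) ^ p)
      ≤ ENNReal.ofReal (2 ^ p) * eLpNorm g (ENNReal.ofReal p) volume ^ p := by
  obtain ⟨G, T, hG, hgG⟩ := hg.exists_isBorelGradient
  have heq := hg.lintegral_rpow_eq hp hgG
  have hfin : ∫⁻ z, ENNReal.ofReal (G z ^ p) ≠ ∞ := by
    rw [heq]
    exact ENNReal.rpow_ne_top_of_nonneg hp.le hg.memLp.2.ne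
  rw [← heq, ← lintegral_const_mul' _ _ ENNReal.ofReal_ne_top]
  refine lintegral_mono_ae ?_
  filter_upwards [hG.ae_log_norm_weakGradient_le hp hfin hf hDf, hG.ae_notMem] with x hx hxT
  rw [← ENNReal.ofReal_mul (by positivity), ← Real.mul_rpow (by norm_num) (hG.nonneg x hxT)]
  refine ENNReal.ofReal_le_ofReal (Real.rpow_le_rpow (Real.log_nonneg ?_) hx hp.le)
  linarith [norm_nonneg (Df x)]

/-- Passage to the infimum over all admissible gradients. -/
theorem lintegral_log_weakGradient_le_seminormN (hp : 0 < p) (hf : AEMeasurable f)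
    {Df : EuclideanSpace ℝ (Fin d) → EuclideanSpace ℝ (Fin d)}
    (hDf : ∀ᵐ x, HasWeakGradientAt f (Df x) x) :
    ∫⁻ x, ENNReal.ofReal (Real.log (1 + ‖Df x‖) ^ p)
      ≤ ENNReal.ofReal (2 ^ p) * seminormN 1 p f ^ p := by
  have h2 : ENNReal.ofReal (2 ^ p) ≠ 0 := by
    rw [ne_eq, ENNReal.ofReal_eq_zero, not_le]; positivity
  rw [mul_comm, ← ENNReal.div_le_iff h2 ENNReal.ofReal_ne_top,
    ← ENNReal.rpow_inv_le_iff hp]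
  refine le_iInf₂ fun g hg => ?_
  rw [ENNReal.rpow_inv_le_iff hp, ENNReal.div_le_iff h2 ENNReal.ofReal_ne_top, mul_comm]
  exact hg.lintegral_log_weakGradient_le hp hf hDf

end LogSobolev

/-! ### Assembly over the sublevel sets -/

theorem mainTheorem7 (p : ℝ) (hp : 1 ≤ p) :
    ∃ C : ℝ≥0, ∀ d : ℕ, 1 ≤ d → ∀ f : EuclideanSpace ℝ (Fin d) → ℝ,
      LogSobolev.MemN 1 p f →
      (∀ᵐ x, LogSobolev.WeaklyDifferentiableAt f x) ∧
      ∀ Df : EuclideanSpace ℝ (Fin d) → EuclideanSpace ℝ (Fin d),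
        (∀ᵐ x, LogSobolev.HasWeakGradientAt f (Df x) x) →
        AEStronglyMeasurable Df volume ∧
        (∫⁻ x, ENNReal.ofReal (Real.log (1 + ‖Df x‖) ^ p)
          ≤ (C : ℝ≥0∞) * LogSobolev.seminormN 1 p f ^ p) ∧
        ∀ᵐ x, Tendsto
          (fun r : ℝ => ⨍⁻ y in Metric.ball (0 : EuclideanSpace ℝ (Fin d)) r,
            ENNReal.ofReal
              (Real.log (1 + |f (x + y) - f x - inner ℝ (Df x) y| / ‖y‖) ^ p) ∂volume)
          (𝓝[>] 0) (𝓝 0) := by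
  have hp0 : 0 < p := one_pos.trans_le hp
  refine ⟨Real.toNNReal (2 ^ p), fun d _ f ⟨hloc, g, hg⟩ => ?_⟩
  have hf := hloc.aemeasurable
  obtain ⟨G, T, hG, hgG⟩ := hg.exists_isBorelGradient
  have hfin : ∫⁻ z, ENNReal.ofReal (G z ^ p) ≠ ∞ := by
    rw [hg.lintegral_rpow_eq hp0 hgG]
    exact ENNReal.rpow_ne_top_of_nonneg hp0.le hg.memLp.2.ne
  have hlevel := fun n : ℕ => hG.exists_weakGradient_on_sublevel hp0 (Nat.cast_add_one_pos n) hfin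
  choose u hum _ hu using hlevel
  have hu' := ae_all_iff.2 hu
  have hcover : ∀ x ∉ T, ∃ n : ℕ, x ∈ LogSobolev.sublevel G T (n + 1) := fun x hx =>
    let ⟨n, hn⟩ := exists_nat_ge (G x)
    ⟨n, hx, by linarith⟩
  refine ⟨?_, fun Df hDf => ⟨?_,
    LogSobolev.lintegral_log_weakGradient_le_seminormN hp0 hf hDf, ?_⟩⟩
  · filter_upwards [hu', hG.ae_notMem] with x hx hxT
    obtain ⟨n, hn⟩ := hcover x hxT
    exact ⟨_, (hx n hn).1⟩
  · have hunion : (⋃ n : ℕ, LogSobolev.sublevel G T (n + 1)) =ᵐ[volume] Set.univ := by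
      rw [eventuallyEq_univ]
      filter_upwards [hG.ae_notMem] with x hxT
      exact Set.mem_iUnion.2 (hcover x hxT)
    rw [← Measure.restrict_univ (μ := volume), ← Measure.restrict_congr_set hunion,
      aestronglyMeasurable_iUnion_iff]
    intro n
    refine (hum n).aestronglyMeasurable.congr ?_
    rw [EventuallyEq, ae_restrict_iff' (hG.measurableSet_sublevel _)]
    filter_upwards [hu n, hDf] with x hx hDx hxE
    exact (hx hxE).1.unique hf hDx
  · filter_upwards [hu', hG.ae_notMem, hDf] with x hx hxT hDx
    obtain ⟨n, hn⟩ := hcover x hxT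
    rw [hDx.unique hf (hx n hn).1]
    exact (hx n hn).2
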